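/- Let $M$ be a smooth $n$-dimensional manifold, $\pi:T^*M\to M$ its cotangent bundle, $\vartheta=p_i\,dx^i$ the tautological form and $\omega=-d\vartheta$ the canonical symplectic form. A hybrid dynamical system $(N,S,X,\Delta)$ consists of a smooth manifold $N$, a smooth embedded hypersurface $S\subset N$ (the guard), a smooth vector field $X$ on $N$ and a smooth map $\Delta:S\to N$ (the reset) such that $\Delta(S)$ is a smooth embedded submanifold, $S\cap\Delta(S)=\emptyset$, and $\overline S\cap\overline{\Delta(S)}$ has codimension at least $2$. Its trajectories follow $\dot z=X(z)$, and are reset by $z^+=\Delta(z^-)$ each time they reach $S$; at a reset time the value of the trajectory is the state $z^-\in S$ before the reset. For $T\ge 0$ let $\varphi_T^{\mathcal H}$ denote the time-$T$ map of the hybrid flow. A point has a Zeno trajectory if there are infinitely many reset times $0\le t_0<t_1<\cdots$ on its trajectory with $t_i\to t_\infty<\infty$; the trajectory is spasmodic if the sequence of the states at its successive reset times escapes every compact set, and steady otherwise. Let $\mathcal H=(T^*M,S^*,X_H,\tilde\Delta)$ be a hybrid Hamiltonian system, that is, a hybrid dynamical system on $T^*M$ obtained as follows: $S\subset M$ and $\Delta:S\to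 M$ satisfy the conditions above on a guard and a reset in $M$, where $S=h^{-1}(0)$ for a smooth function $h$ on an open subset of $M$ with $dh\neq 0$ on $S$; $H:T^*M\to\mathbb R$ is smooth; $X_H$ is its Hamiltonian vector field, $i_{X_H}\omega=dH$; $S^*=\{z\in T^*M:\pi(z)\in S,\ (\pi^*dh)(X_H)(z)>0\}$; and $\tilde\Delta:S^*\to T^*M$ is smooth with $\pi\circ\tilde\Delta=\Delta\circ\pi$ and $(\mathrm{Id}\times\tilde\Delta)^*\vartheta_H=\iota^*\vartheta_H$, where $\vartheta_H=p_i\,dx^i-H\,dt$ on $\mathbb R\times T^*M$ and $\iota:\mathbb R\times S^*\hookrightarrow\mathbb R\times T^*M$ is the inclusion. Suppose that $\mathcal H$ has no spasmodic Zeno trajectories. Let $\mathcal N\subset T^*M$ be the set of the points that have a steady Zeno trajectory, let $x\in M$ be such that $T_x^*M\cap\mathcal N$ is a Lebesgue null set in the vector space $T_x^*M$, and put $V_x=T_x^*M\setminus\mathcal N$. Let $T\ge 0$ and let $\mathcal L\subset T^*M$ be an embedded Lagrangian submanifold with $$\varphi_T^{\mathcal H}(V_x)\cap\mathcal L=\emptyset,\qquad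 \overline{\varphi_T^{\mathcal H}(V_x)}\cap\mathcal L\neq\emptyset .$$ Then there are embedded Lagrangian submanifolds $\tilde{\mathcal L}$ arbitrarily close to $\mathcal L$ with $$\varphi_T^{\mathcal H}(V_x)\cap\tilde{\mathcal L}\neq\emptyset .$$ Here "arbitrarily close" means: for each neighbourhood $\mathcal U$ of the inclusion $\mathcal L\hookrightarrow T^*M$ in the strong (Whitney) $C^\infty$ topology on $C^\infty(\mathcal L,T^*M)$ one can take $\tilde{\mathcal L}=j(\mathcal L)$ for a smooth embedding $j\in\mathcal U$. -/

import Mathlib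

open scoped Manifold ContDiff Topology
open Set Filter

noncomputable section

/-! ### Submanifolds, hybrid dynamical systems and their trajectories -/

section Hybrid

variable {E : Type*} [NormedAddCommGroup E] [NormedSpace ℝ E]
  {H : Type*} [TopologicalSpace H] (I : ModelWithCorners ℝ E H)
  {N : Type*} [TopologicalSpace N] [ChartedSpace H N]

/-- Near its point `a` the set `A` is a slice of codimension `c`: some smooth chart around `a`
identifies `A` with a linear subspace of codimension `c`. -/
def IsSliceAt (A : Set N) (a : N) (c : ℕ) : Prop :=
  ∃ φ ∈ IsManifold.maximalAtlas I ∞ N, a ∈ φ.source ∧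
    ∃ W : Submodule ℝ E, Module.finrank ℝ W + c = Module.finrank ℝ E ∧
      ∀ y ∈ φ.source, y ∈ A ↔ φ.extend I y ∈ W

/-- `A` is a smooth embedded submanifold (of any dimension). -/
def IsEmbeddedSubmanifold (A : Set N) : Prop :=
  ∀ a ∈ A, ∃ c, IsSliceAt I A a c

/-- `A` is a smooth embedded submanifold of codimension one. -/
def IsEmbeddedHypersurface (A : Set N) : Prop :=
  ∀ a ∈ A, IsSliceAt I A a 1

/-- `A`, which need not be a submanifold, has codimension at least two: it is empty, or in all
charts its Hausdorff dimension is at most `dim N - 2`. -/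
def HasCodimAtLeastTwo (A : Set N) : Prop :=
  A = ∅ ∨ ∀ z : N,
    dimH (extChartAt I z '' (A ∩ (extChartAt I z).source)) + 2 ≤ (Module.finrank ℝ E : ENNReal)

/-- The conditions on a guard `S` and a reset `Δ : S → N` of a hybrid dynamical system. The reset
is given as a function on `N` of which only the restriction to `S` matters. -/
structure IsGuardReset (S : Set N) (Δ : N → N) : Prop where
  guard : IsEmbeddedHypersurface I S
  smooth : ContMDiffOn I I ∞ Δ S
  image : IsEmbeddedSubmanifold I (Δ '' S)
  disjoint : Disjoint S (Δ '' S)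
  codim : HasCodimAtLeastTwo I (closure S ∩ closure (Δ '' S))

variable (N) in
/-- A hybrid dynamical system `(N, S, X, Δ)` on the smooth manifold `N`. -/
structure HybridDynamicalSystem [IsManifold I 1 N] where
  /-- the guard `S` -/
  guard : Set N
  /-- the vector field `X` -/
  field : (z : N) → TangentSpace I z
  /-- the reset `Δ`; its values outside the guard are irrelevant -/
  reset : N → N
  smooth_field : ContMDiff I I.tangent ∞ (fun z => (⟨z, field z⟩ : TangentBundle I N))
  isGuardReset : IsGuardReset I guard reset

namespace HybridDynamicalSystem

variable {I} [IsManifold I 1 N] (𝓗 : HybridDynamicalSystem I N)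

/-- `γ` is a trajectory of `𝓗` on `[0, τ)`. Up to and including a time `t` it follows the vector
field, so that at a reset time `γ t ∈ S` is the state before the reset. After `t` it follows the
vector field from `Δ (γ t)` if `γ t` lies in the guard and from `γ t` otherwise. -/
structure IsTrajectory (γ : ℝ → N) (τ : ℝ) : Prop where
  left : ∀ t ∈ Ioo 0 τ, ∃ δ > 0, IsMIntegralCurveOn γ 𝓗.field (Ioc (t - δ) t)
  right : ∀ t ∈ Ico 0 τ, ∃ δ > 0, ∃ η : ℝ → N,
    IsMIntegralCurveOn η 𝓗.field (Ico t (t + δ)) ∧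
    (γ t ∈ 𝓗.guard → η t = 𝓗.reset (γ t)) ∧ (γ t ∉ 𝓗.guard → η t = γ t) ∧
    ∀ s ∈ Ioo t (t + δ), γ s = η s

/-- The image `φ_T(V)` of the set `V` under the time-`T` map of the hybrid flow: the states at
time `T` of the trajectories that start in `V`. -/
def flowImage (T : ℝ) (V : Set N) : Set N :=
  {w | ∃ (γ : ℝ → N) (τ : ℝ), T < τ ∧ 𝓗.IsTrajectory γ τ ∧ γ 0 ∈ V ∧ γ T = w}

/-- `t` is an increasing sequence of reset times of the trajectory `γ` from `z`, with finite
limit `τ`. -/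
structure IsZenoExecution (z : N) (γ : ℝ → N) (t : ℕ → ℝ) (τ : ℝ) : Prop where
  trajectory : 𝓗.IsTrajectory γ τ
  start : γ 0 = z
  strictMono : StrictMono t
  nonneg : ∀ i, 0 ≤ t i
  mem_guard : ∀ i, γ (t i) ∈ 𝓗.guard
  tendsto : Tendsto t atTop (𝓝 τ)

/-- The point `z` has a Zeno trajectory. -/
def IsZeno (z : N) : Prop := ∃ γ t τ, 𝓗.IsZenoExecution z γ t τ

/-- The point `z` has a spasmodic Zeno trajectory: the sequence of the states at its successive
reset times (the sequence `t` lists all of them) escapes every compact set. -/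
def IsSpasmodicZeno (z : N) : Prop :=
  ∃ γ t τ, 𝓗.IsZenoExecution z γ t τ ∧
    (∀ s ∈ Ico 0 τ, γ s ∈ 𝓗.guard → s ∈ range t) ∧
    Tendsto (fun i => γ (t i)) atTop (cocompact N)

/-- The set `𝒩` of the points that have a steady, i.e. not spasmodic, Zeno trajectory. -/
def steadyZenoSet : Set N := {z | 𝓗.IsZeno z ∧ ¬ 𝓗.IsSpasmodicZeno z}

end HybridDynamicalSystem

end Hybrid

/-! ### Basic neighbourhoods in the strong (Whitney) `C^∞` topology -/

section Whitney

variable {E : Type*} [NormedAddCommGroup E] [NormedSpace ℝ E]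
  {H : Type*} [TopologicalSpace H] (I : ModelWithCorners ℝ E H)
  {P : Type*} [TopologicalSpace P] [ChartedSpace H P]
  {E' : Type*} [NormedAddCommGroup E'] [NormedSpace ℝ E']
  {H' : Type*} [TopologicalSpace H'] (I' : ModelWithCorners ℝ E' H')
  {N : Type*} [TopologicalSpace N] [ChartedSpace H' N]

/-- The data of a basic neighbourhood of `f : P → N` in the strong (Whitney) `C^∞` topology:
an order `k`, a locally finite family of compact sets `K a ⊆ P`, charts of `P` around `K a` and of
`N` around `f (K a)`, and positive numbers `ε a`. -/
structure WhitneyNhd (f : P → N) where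
  k : ℕ
  K : ℕ → Set P
  isCompact : ∀ a, IsCompact (K a)
  locallyFinite : LocallyFinite K
  chartP : ℕ → OpenPartialHomeomorph P H
  chartP_mem : ∀ a, chartP a ∈ IsManifold.maximalAtlas I ∞ P
  subset_source : ∀ a, K a ⊆ (chartP a).source
  chartN : ℕ → OpenPartialHomeomorph N H'
  chartN_mem : ∀ a, chartN a ∈ IsManifold.maximalAtlas I' ∞ N
  mapsTo : ∀ a, MapsTo f (K a) (chartN a).source
  ε : ℕ → ℝ
  ε_pos : ∀ a, 0 < ε a

namespace WhitneyNhd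

variable {I I'} {f : P → N}

/-- The map `g` in the `a`-th pair of charts. -/
def inCharts (𝒰 : WhitneyNhd I I' f) (a : ℕ) (g : P → N) : E → E' :=
  (𝒰.chartN a).extend I' ∘ g ∘ ((𝒰.chartP a).extend I).symm

/-- The smooth map `g` belongs to the basic neighbourhood `𝒰` of `f`: over each `K a` the partial
derivatives of `g` of order at most `k` in the charts differ from those of `f` by less than
`ε a`. -/
def Contains (𝒰 : WhitneyNhd I I' f) (g : P → N) : Prop :=
  ContMDiff I I' ∞ g ∧ ∀ a, MapsTo g (𝒰.K a) (𝒰.chartN a).source ∧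
    ∀ m ≤ 𝒰.k, ∀ y ∈ (𝒰.chartP a).extend I '' 𝒰.K a,
      ‖iteratedFDeriv ℝ m (𝒰.inCharts a g) y - iteratedFDeriv ℝ m (𝒰.inCharts a f) y‖ < 𝒰.ε a

end WhitneyNhd

end Whitney

/-! ### The cotangent bundle and hybrid Hamiltonian systems -/

section Cotangent

/-- The model space `ℝⁿ`. -/
abbrev RSpace (n : ℕ) : Type := EuclideanSpace ℝ (Fin n)

/-- The dual of the model space. -/
abbrev RDual (n : ℕ) : Type := RSpace n →L[ℝ] ℝ

variable (n : ℕ) (M : Type*) [TopologicalSpace M] [ChartedSpace (RSpace n) M]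
  [IsManifold (𝓡 n) ∞ M]

/-- The cotangent bundle `T^*M`, with Mathlib's structure of a smooth vector bundle. -/
abbrev CotangentBundle : Type _ :=
  Bundle.TotalSpace (RDual n) (fun x : M => TangentSpace (𝓡 n) x →L[ℝ] Bundle.Trivial M ℝ x)

/-- The model with corners of the manifold `T^*M`. -/
abbrev cotangentModel : ModelWithCorners ℝ (RSpace n × RDual n) (ModelProd (RSpace n) (RDual n)) :=
  (𝓡 n).prod 𝓘(ℝ, RDual n)

variable {n M}

/-- The differential `df_x : T_x M → ℝ` of a function on `M`. -/
def differential (f : M → ℝ) (x : M) : TangentSpace (𝓡 n) x →L[ℝ] ℝ :=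
  mfderiv (𝓡 n) 𝓘(ℝ, ℝ) f x

/-- The derivative `T_z T^*M → T_{π z} M` of the projection `π : T^*M → M`. -/
def dproj (z : CotangentBundle n M) :
    TangentSpace (cotangentModel n) z →L[ℝ] TangentSpace (𝓡 n) z.proj :=
  mfderiv (cotangentModel n) (𝓡 n) (Bundle.TotalSpace.proj : CotangentBundle n M → M) z

/-- The tautological one-form `ϑ = p_i dx^i` on `T^*M`. -/
def tautologicalForm (z : CotangentBundle n M) (v : TangentSpace (cotangentModel n) z) : ℝ :=
  z.2 (dproj z v)

/-- The action form `ϑ_H = p_i dx^i - H dt` on `ℝ × T^*M` at a point `(t, z)` (it does not depend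
on `t`), applied to the tangent vector `(a, v)`. -/
def actionForm (H : CotangentBundle n M → ℝ) (z : CotangentBundle n M) (a : ℝ)
    (v : TangentSpace (cotangentModel n) z) : ℝ :=
  tautologicalForm z v - H z * a

/-- The canonical symplectic form `ω = -dϑ = dx^i ∧ dp_i` on `T^*M`. By definition the tangent
space at `z` is `ℝⁿ × (ℝⁿ)^*`, by means of the chart at `z`; this is the chart of `T^*M` with the
canonical coordinates `(x^i, p_i)` that belong to the chart of `M` at `π z`. -/
def symplecticForm (z : CotangentBundle n M) (u v : TangentSpace (cotangentModel n) z) : ℝ :=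
  let u' : RSpace n × RDual n := u
  let v' : RSpace n × RDual n := v
  v'.2 u'.1 - u'.2 v'.1

/-- `X` is the Hamiltonian vector field of `H`, i.e. `i_X ω = dH`. -/
def IsHamiltonianVectorField (H : CotangentBundle n M → ℝ)
    (X : (z : CotangentBundle n M) → TangentSpace (cotangentModel n) z) : Prop :=
  ∀ z v, symplecticForm z (X z) v = mfderiv (cotangentModel n) 𝓘(ℝ, ℝ) H z v

/-- `i : P → T^*M` is a smooth embedding of an `n`-dimensional manifold with `i^*ω = 0`, so that
its image is an (embedded) Lagrangian submanifold of `T^*M`. -/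
structure IsLagrangianEmbedding {P : Type*} [TopologicalSpace P] [ChartedSpace (RSpace n) P]
    (i : P → CotangentBundle n M) : Prop where
  isSmoothEmbedding : Manifold.IsSmoothEmbedding (𝓡 n) (cotangentModel n) ∞ i
  isotropic : ∀ (q : P) (u v : TangentSpace (𝓡 n) q),
    symplecticForm (i q) (mfderiv (𝓡 n) (cotangentModel n) i q u)
      (mfderiv (𝓡 n) (cotangentModel n) i q v) = 0

variable (n M) in
/-- A hybrid Hamiltonian system `(T^*M, S^*, X_H, Δ̃)`: the lift of a guard `S ⊆ M` and a reset
`Δ : S → M` to the cotangent bundle by means of a Hamiltonian `H`. The guard `S` is the zero set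
of a function `h` without critical zeros that is defined on an open set containing `S`. -/
structure HybridHamiltonianSystem where
  /-- the domain of the function `h` -/
  dom : Set M
  isOpen_dom : IsOpen dom
  /-- the defining function of the guard `S` -/
  h : M → ℝ
  smooth_h : ContMDiffOn (𝓡 n) 𝓘(ℝ, ℝ) ∞ h dom
  dh_ne_zero : ∀ x ∈ dom, h x = 0 → differential (n := n) h x ≠ 0
  /-- the reset `Δ` on `M`; its values outside `S` are irrelevant -/
  Δ : M → M
  isGuardReset : IsGuardReset (𝓡 n) {x | x ∈ dom ∧ h x = 0} Δ
  /-- the Hamiltonian -/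
  H : CotangentBundle n M → ℝ
  smooth_H : ContMDiff (cotangentModel n) 𝓘(ℝ, ℝ) ∞ H
  /-- the hybrid dynamical system `(T^*M, S^*, X_H, Δ̃)` -/
  lift : HybridDynamicalSystem (cotangentModel n) (CotangentBundle n M)
  field_eq : IsHamiltonianVectorField H lift.field
  /-- `S^*` is the extended guard, consisting of the outward pointing momenta over `S`. -/
  guard_eq : lift.guard = {z | (z.proj ∈ dom ∧ h z.proj = 0) ∧
    0 < differential h z.proj (dproj z (lift.field z))}
  /-- `Δ̃` covers `Δ`. -/
  proj_reset : ∀ z ∈ lift.guard, (lift.reset z).proj = Δ z.proj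
  /-- `(Id × Δ̃)^* ϑ_H = ι^* ϑ_H` on `ℝ × S^*`. The vectors `v` with `dh (dπ v) = 0` are those
  tangent to `S^*`, and on these every derivative of `Δ̃` within `S^*` has the same value. -/
  reset_pullback : ∀ z ∈ lift.guard, ∀ (a : ℝ) (v : TangentSpace (cotangentModel n) z),
    differential h z.proj (dproj z v) = 0 →
    actionForm H (lift.reset z) a
        (mfderivWithin (cotangentModel n) (cotangentModel n) lift.reset lift.guard z v) =
      actionForm H z a v

namespace HybridHamiltonianSystem

variable (𝓗 : HybridHamiltonianSystem n M)

/-- The system has no spasmodic Zeno trajectories. -/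
def FreeOfSpasmodicZeno : Prop := ∀ z, ¬ 𝓗.lift.IsSpasmodicZeno z

/-- The fiber `T_x^*M` contains almost no points with a steady Zeno trajectory. The null sets of
the smooth measures on the vector space `T_x^*M` are those of its Haar (Lebesgue) measures. -/
def AlmostNoSteadyZeno (x : M) : Prop :=
  ∀ μ : MeasureTheory.Measure (RDual n), μ.IsAddHaarMeasure →
    μ {p : RDual n | (⟨x, p⟩ : CotangentBundle n M) ∈ 𝓗.lift.steadyZenoSet} = 0

/-- The set `V_x = T_x^*M \ 𝒩`. -/
def nonZenoFiber (x : M) : Set (CotangentBundle n M) :=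
  {z | z.proj = x} \ 𝓗.lift.steadyZenoSet

end HybridHamiltonianSystem

end Cotangent

end

/-!
In complex coordinates `z = x + i p` the symplectic form is `Im ⟪u, v⟫`, and a twist
`z ↦ a + exp (i θ (|z - a|²)) (z - a)` preserves it: the derivative of a twist is a unitary map
after a symplectic transvection along `z - a`. If `θ` is `π` near `0` and vanishes far from `0`,
then the twist is a point reflection near `a` that is cut off to the identity, and two such
reflections, about `a` and `a + c`, compose to a compactly supported symplectic map that translates
by `2 c` near `a`. In a Darboux chart at `w = i q` this gives symplectomorphisms `Ψ_c` of `T^*M`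
that depend smoothly on `c`, with `Ψ_0 = id`, and move `w` to every point near `w`. The Lagrangian
embeddings `Ψ_c ∘ i` differ from `i` only on a compact set and tend to `i` there with all
derivatives, so for small `c` they lie in a given Whitney neighbourhood of `i`. Together their
images meet every set that has `w` in its closure.
-/

noncomputable section

section Twist

variable {E : Type*} [NormedAddCommGroup E] [InnerProductSpace ℂ E]

/-- The rotation of a complex inner product space about `a` by the angle `θ (‖z - a‖ ^ 2)`, which
depends on the distance from `a`. It is the time-one map of a Hamiltonian flow and so preserves the
symplectic form `Im ⟪u, v⟫`. -/
def twist (θ : ℝ → ℝ) (a z : E) : E :=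
  a + Complex.exp (θ (‖z - a‖ ^ 2) * Complex.I) • (z - a)

variable {θ : ℝ → ℝ} {a z : E}

@[simp]
lemma twist_self (θ : ℝ → ℝ) (a : E) : twist θ a a = a := by
  simp [twist]

lemma norm_twist_sub (θ : ℝ → ℝ) (a z : E) : ‖twist θ a z - a‖ = ‖z - a‖ := by
  rw [twist, add_sub_cancel_left, norm_smul, Complex.norm_exp_ofReal_mul_I, one_mul]

@[simp]
lemma twist_twist_neg (θ : ℝ → ℝ) (a z : E) : twist θ a (twist (-θ) a z) = z := by
  rw [twist, norm_twist_sub]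
  simp [twist, smul_smul, ← Complex.exp_add]

@[simp]
lemma twist_neg_twist (θ : ℝ → ℝ) (a z : E) : twist (-θ) a (twist θ a z) = z := by
  simpa using twist_twist_neg (-θ) a z

lemma twist_eq_self (h : θ (‖z - a‖ ^ 2) = 0) : twist θ a z = z := by
  simp [twist, h]

lemma twist_eq_reflection (h : θ (‖z - a‖ ^ 2) = Real.pi) : twist θ a z = a - (z - a) := by
  rw [twist, h, Complex.exp_pi_mul_I, neg_one_smul, ← sub_eq_add_neg]

lemma im_inner_transvection (s : ℝ) (w u v : E) :
    (inner ℂ (u + ((s * (inner ℂ w u).re : ℝ) * Complex.I) • w)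
      (v + ((s * (inner ℂ w v).re : ℝ) * Complex.I) • w)).im = (inner ℂ u v).im := by
  have hsymm : (inner ℂ u w).re = (inner ℂ w u).re := inner_re_symm (𝕜 := ℂ) u w
  have hself : (inner ℂ w w).im = 0 := inner_self_im (𝕜 := ℂ) w
  simp only [inner_add_left, inner_add_right, inner_smul_left, inner_smul_right, Complex.add_im,
    Complex.add_re, Complex.mul_im, Complex.mul_re, map_mul, Complex.conj_ofReal, Complex.conj_I,
    Complex.neg_re, Complex.neg_im, Complex.I_re, Complex.I_im, Complex.ofReal_re,
    Complex.ofReal_im, hsymm, hself]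
  ring

variable [NormedSpace ℝ E] [IsScalarTower ℝ ℂ E]

lemma contDiff_twist (hθ : ContDiff ℝ ∞ θ) : ContDiff ℝ ∞ fun x : E × E => twist θ x.1 x.2 := by
  have hsub : ContDiff ℝ ∞ fun x : E × E => x.2 - x.1 := contDiff_snd.sub contDiff_fst
  have hangle : ContDiff ℝ ∞ fun x : E × E => (θ (‖x.2 - x.1‖ ^ 2) : ℂ) :=
    Complex.ofRealCLM.contDiff.comp (hθ.comp (hsub.norm_sq ℂ))
  exact contDiff_fst.add ((hangle.mul contDiff_const).cexp.smul hsub)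

lemma hasFDerivAt_norm_sub_sq (a z : E) :
    HasFDerivAt (fun y => ‖y - a‖ ^ 2)
      ((2 : ℝ) • Complex.reCLM ∘L (innerSL ℂ (z - a)).restrictScalars ℝ) z := by
  have hsub := (hasFDerivAt_id (𝕜 := ℝ) z).sub_const a
  have hre := Complex.reCLM.hasFDerivAt.comp z (hsub.inner ℂ hsub)
  have hfun : (fun y => ‖y - a‖ ^ 2) = Complex.reCLM ∘ fun y => inner ℂ (y - a) (y - a) :=
    funext fun y => norm_sq_eq_re_inner (𝕜 := ℂ) (y - a)
  rw [hfun]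
  refine hre.congr_fderiv (ContinuousLinearMap.ext fun v => ?_)
  have hsymm : (inner ℂ v (z - a)).re = (inner ℂ (z - a) v).re := inner_re_symm (𝕜 := ℂ) v (z - a)
  simp [hsymm, two_mul, -map_sub, ← inner_sub_left]

lemma fderiv_twist (hθ : ContDiff ℝ ∞ θ) (a z v : E) :
    fderiv ℝ (twist θ a) z v = Complex.exp (θ (‖z - a‖ ^ 2) * Complex.I) •
      (v + ((2 * deriv θ (‖z - a‖ ^ 2) * (inner ℂ (z - a) v).re : ℝ) * Complex.I) • (z - a)) := by
  have hθ' := ((hθ.differentiable (by simp)) (‖z - a‖ ^ 2)).hasDerivAt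
  have hangle := hθ'.comp_hasFDerivAt z (hasFDerivAt_norm_sub_sq a z)
  have hexp := ((Complex.ofRealCLM.hasFDerivAt.comp z hangle).mul_const Complex.I).cexp
  have h := (hexp.smul ((hasFDerivAt_id (𝕜 := ℝ) z).sub_const a)).const_add a
  rw [show fderiv ℝ (twist θ a) z = _ from h.fderiv]
  simp only [add_apply, smul_apply, Function.comp_apply,
    ContinuousLinearMap.id_apply, ContinuousLinearMap.smulRight_apply,
    ContinuousLinearMap.comp_apply, Complex.ofRealCLM_apply, smul_add, smul_smul, id_eq,
    Complex.reCLM_apply, ContinuousLinearMap.coe_restrictScalars', innerSL_apply_apply, smul_eq_mul]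
  push_cast
  congr 2
  ring

lemma im_inner_fderiv_twist (hθ : ContDiff ℝ ∞ θ) (a z u v : E) :
    (inner ℂ (fderiv ℝ (twist θ a) z u) (fderiv ℝ (twist θ a) z v)).im = (inner ℂ u v).im := by
  have hunit : starRingEnd ℂ (Complex.exp (θ (‖z - a‖ ^ 2) * Complex.I)) *
      Complex.exp (θ (‖z - a‖ ^ 2) * Complex.I) = 1 := by
    rw [Complex.conj_mul', Complex.norm_exp_ofReal_mul_I]
    norm_num
  rw [fderiv_twist hθ, fderiv_twist hθ, inner_smul_left, inner_smul_right, ← mul_assoc, hunit,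
    one_mul, im_inner_transvection]

/-- A twist as a diffeomorphism. -/
def twistDiffeomorph (θ : ℝ → ℝ) (hθ : ContDiff ℝ ∞ θ) (a : E) : E ≃ₘ^∞⟮𝓘(ℝ, E), 𝓘(ℝ, E)⟯ E where
  toFun := twist θ a
  invFun := twist (-θ) a
  left_inv := twist_neg_twist θ a
  right_inv := twist_twist_neg θ a
  contMDiff_toFun := ((contDiff_twist hθ).comp (contDiff_prodMk_right a)).contMDiff
  contMDiff_invFun := ((contDiff_twist hθ.neg).comp (contDiff_prodMk_right a)).contMDiff

end Twist

section LocalTranslation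

/-- A smooth function equal to `π` on `[0, r ^ 2 / 2]` and to `0` on `[r ^ 2, ∞)`: the twist by this
angle is a point reflection near its centre and the identity off the ball of radius `r`. -/
def reflectionAngle (r t : ℝ) : ℝ :=
  Real.pi * Real.smoothTransition (2 - 2 * t / r ^ 2)

lemma contDiff_reflectionAngle (r : ℝ) : ContDiff ℝ ∞ (reflectionAngle r) := by
  have h : ContDiff ℝ ∞ fun t : ℝ => 2 - 2 * t / r ^ 2 := by fun_prop
  exact contDiff_const.mul (Real.smoothTransition.contDiff.comp h)

lemma reflectionAngle_of_le {r t : ℝ} (hr : 0 < r) (h : t ≤ r ^ 2 / 2) :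
    reflectionAngle r t = Real.pi := by
  have : 2 * t / r ^ 2 ≤ 1 := by
    rw [div_le_one (by positivity)]
    linarith
  rw [reflectionAngle, Real.smoothTransition.one_of_one_le (by linarith), mul_one]

lemma reflectionAngle_of_ge {r t : ℝ} (hr : 0 < r) (h : r ^ 2 ≤ t) : reflectionAngle r t = 0 := by
  have : 2 ≤ 2 * t / r ^ 2 := by
    rw [le_div_iff₀ (by positivity)]
    linarith
  rw [reflectionAngle, Real.smoothTransition.zero_of_nonpos (by linarith), mul_zero]

variable {E : Type*} [NormedAddCommGroup E] [InnerProductSpace ℂ E] [NormedSpace ℝ E]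
  [IsScalarTower ℝ ℂ E] {r : ℝ} {a c : E}

/-- The composition of two reflections, about `a` and about `a + c`, each cut off at distance `r`
from its centre. Near `a` it is the translation by `2 • c`, if `c` is small. -/
def localTranslation (r : ℝ) (a c : E) : E ≃ₘ^∞⟮𝓘(ℝ, E), 𝓘(ℝ, E)⟯ E :=
  (twistDiffeomorph _ (contDiff_reflectionAngle r).neg a).trans
    (twistDiffeomorph _ (contDiff_reflectionAngle r) (a + c))

lemma localTranslation_apply (r : ℝ) (a c z : E) :
    localTranslation r a c z =
      twist (reflectionAngle r) (a + c) (twist (-reflectionAngle r) a z) :=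
  rfl

lemma contDiff_localTranslation (r : ℝ) (a : E) :
    ContDiff ℝ ∞ fun x : E × E => localTranslation r a x.1 x.2 := by
  have hinner : ContDiff ℝ ∞ fun x : E × E => twist (-reflectionAngle r) a x.2 :=
    (contDiff_twist (contDiff_reflectionAngle r).neg).comp (contDiff_const.prodMk contDiff_snd)
  exact (contDiff_twist (contDiff_reflectionAngle r)).comp
    ((contDiff_const.add contDiff_fst).prodMk hinner)

lemma localTranslation_zero (r : ℝ) (a z : E) : localTranslation r a 0 z = z := by
  simp [localTranslation_apply]

lemma localTranslation_center (hr : 0 < r) (hc : ‖c‖ ^ 2 ≤ r ^ 2 / 2) :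
    localTranslation r a c a = a + (2 : ℝ) • c := by
  rw [localTranslation_apply, twist_self, twist_eq_reflection]
  · rw [two_smul]
    abel
  · rw [sub_add_cancel_left, norm_neg]
    exact reflectionAngle_of_le hr hc

lemma localTranslation_eq_self (hr : 0 < r) {z : E} (hz : z ∉ Metric.closedBall a (r + ‖c‖)) :
    localTranslation r a c z = z := by
  rw [Metric.mem_closedBall, not_le, dist_eq_norm] at hz
  have hangle {b : E} (hb : r ≤ ‖z - b‖) : reflectionAngle r (‖z - b‖ ^ 2) = 0 :=
    reflectionAngle_of_ge hr (by gcongr)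
  have ha : r ≤ ‖z - a‖ := by linarith [norm_nonneg c]
  have hac : r ≤ ‖z - (a + c)‖ := by
    have := norm_sub_norm_le (z - a) c
    rw [sub_sub] at this
    linarith
  rw [localTranslation_apply, twist_eq_self (a := a) (by simp [hangle ha]),
    twist_eq_self (hangle hac)]

lemma localTranslation_eq_self_of_norm_le (hr : 0 < r) (hc : ‖c‖ ≤ r) {z : E}
    (hz : z ∉ Metric.closedBall a (2 * r)) :
    localTranslation r a c z = z :=
  localTranslation_eq_self hr fun h => hz (Metric.closedBall_subset_closedBall (by linarith) h)

lemma im_inner_fderiv_localTranslation (r : ℝ) (a c z u v : E) :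
    (inner ℂ (fderiv ℝ (localTranslation r a c) z u) (fderiv ℝ (localTranslation r a c) z v)).im =
      (inner ℂ u v).im := by
  have hθ := contDiff_reflectionAngle r
  have hneg : ContDiff ℝ ∞ (-reflectionAngle r) := hθ.neg
  have hdiff {θ : ℝ → ℝ} (hθ : ContDiff ℝ ∞ θ) (b : E) : Differentiable ℝ (twist θ b) :=
    ((contDiff_twist hθ).comp (contDiff_prodMk_right b)).differentiable (by simp)
  have hcomp : fderiv ℝ (localTranslation r a c) z =
      (fderiv ℝ (twist (reflectionAngle r) (a + c)) (twist (-reflectionAngle r) a z)).comp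
        (fderiv ℝ (twist (-reflectionAngle r) a) z) :=
    fderiv_comp z (hdiff hθ _ _) (hdiff hneg _ _)
  rw [hcomp, ContinuousLinearMap.comp_apply, ContinuousLinearMap.comp_apply,
    im_inner_fderiv_twist hθ, im_inner_fderiv_twist hneg]

end LocalTranslation

section ExtendByIdentity

variable {X Y : Type*} [TopologicalSpace X] [TopologicalSpace Y] {ψ : OpenPartialHomeomorph X Y}
  {Φ : Y → Y} {K : Set Y} {z : X}

open Classical in
/-- The map that is given by `Φ` in the chart `ψ` and by the identity off the domain of the chart.
It inherits the regularity of `Φ` if `Φ` is the identity off a compact subset of the target. -/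
def extendByIdentity (ψ : OpenPartialHomeomorph X Y) (Φ : Y → Y) (z : X) : X :=
  if z ∈ ψ.source then ψ.symm (Φ (ψ z)) else z

lemma extendByIdentity_of_mem (hz : z ∈ ψ.source) : extendByIdentity ψ Φ z = ψ.symm (Φ (ψ z)) :=
  if_pos hz

lemma extendByIdentity_of_notMem (hz : z ∉ ψ.source) : extendByIdentity ψ Φ z = z :=
  if_neg hz

lemma extendByIdentity_id (ψ : OpenPartialHomeomorph X Y) : extendByIdentity ψ id = id := by
  ext z
  by_cases hz : z ∈ ψ.source
  · rw [extendByIdentity_of_mem hz, id, ψ.left_inv hz, id]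
  · exact extendByIdentity_of_notMem hz

lemma extendByIdentity_eq_self (hid : ∀ y ∉ K, Φ y = y) (hz : z ∉ ψ.symm '' K) :
    extendByIdentity ψ Φ z = z := by
  by_cases hzψ : z ∈ ψ.source
  · have hzK : ψ z ∉ K := fun h => hz ⟨ψ z, h, ψ.left_inv hzψ⟩
    rw [extendByIdentity_of_mem hzψ, hid _ hzK, ψ.left_inv hzψ]
  · exact extendByIdentity_of_notMem hzψ

lemma compl_image_symm_mem_nhds [T2Space X] (hK : IsCompact K) (hKψ : K ⊆ ψ.target)
    (hz : z ∉ ψ.source) : (ψ.symm '' K)ᶜ ∈ 𝓝 z := by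
  have hclosed : IsClosed (ψ.symm '' K) :=
    (hK.image_of_continuousOn (ψ.continuousOn_symm.mono hKψ)).isClosed
  refine hclosed.isOpen_compl.mem_nhds ?_
  rintro ⟨y, hy, rfl⟩
  exact hz (ψ.map_target (hKψ hy))

lemma mapsTo_of_injective_of_eq_self_off {α : Type*} {f : α → α} {K U : Set α}
    (hf : Function.Injective f) (hKU : K ⊆ U) (hid : ∀ y ∉ K, f y = y) : MapsTo f U U := by
  intro y hy
  by_contra hfy
  have hfix : f y = y := hf (hid (f y) fun h => hfy (hKU h))
  exact hfy (hfix.symm ▸ hy)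

lemma extendByIdentity_extendByIdentity {Φ' : Y → Y} (hΦ : MapsTo Φ ψ.target ψ.target)
    (hinv : ∀ y, Φ' (Φ y) = y) (z : X) :
    extendByIdentity ψ Φ' (extendByIdentity ψ Φ z) = z := by
  by_cases hz : z ∈ ψ.source
  · have hΦz := hΦ (ψ.map_source hz)
    rw [extendByIdentity_of_mem hz, extendByIdentity_of_mem (ψ.map_target hΦz), ψ.right_inv hΦz,
      hinv, ψ.left_inv hz]
  · rw [extendByIdentity_of_notMem hz, extendByIdentity_of_notMem hz]

lemma eventually_chart_extendByIdentity (hΦ : MapsTo Φ ψ.target ψ.target) (hz : z ∈ ψ.source) :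
    ∀ᶠ y in 𝓝 z, ψ (extendByIdentity ψ Φ y) = Φ (ψ y) := by
  filter_upwards [ψ.open_source.mem_nhds hz] with y hy
  rw [extendByIdentity_of_mem hy, ψ.right_inv (hΦ (ψ.map_source hy))]

lemma exists_closedBall_subset_target {Y : Type*} [PseudoMetricSpace Y]
    (ψ : OpenPartialHomeomorph X Y) {w : X} (hw : w ∈ ψ.source) {W : Set X} (hW : W ∈ 𝓝 w) :
    ∃ ρ > 0, Metric.closedBall (ψ w) ρ ⊆ ψ.target ∧ ψ.symm '' Metric.closedBall (ψ w) ρ ⊆ W := by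
  obtain ⟨ρ, hρ, hball⟩ := Metric.nhds_basis_closedBall.mem_iff.1
    (inter_mem (ψ.open_target.mem_nhds (ψ.map_source hw)) (ψ.tendsto_symm hw hW))
  exact ⟨ρ, hρ, fun y hy => (hball hy).1, image_subset_iff.2 fun y hy => (hball hy).2⟩

end ExtendByIdentity

section SmoothExtension

variable {E : Type*} [NormedAddCommGroup E] [NormedSpace ℝ E]
  {H : Type*} [TopologicalSpace H] {I : ModelWithCorners ℝ E H}
  {N : Type*} [TopologicalSpace N] [ChartedSpace H N] [T2Space N]
  {F : Type*} [NormedAddCommGroup F] [NormedSpace ℝ F]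
  {ψ : OpenPartialHomeomorph N F} {K : Set F}

lemma contMDiffAt_extendByIdentity (hψ : ContMDiffOn I 𝓘(ℝ, F) ∞ ψ ψ.source)
    (hψsymm : ContMDiffOn 𝓘(ℝ, F) I ∞ ψ.symm ψ.target) (hK : IsCompact K) (hKψ : K ⊆ ψ.target)
    {G : Type*} [NormedAddCommGroup G] [NormedSpace ℝ G] {Φ : G → F → F} {c₀ : G}
    (hΦ : ContDiff ℝ ∞ fun x : G × F => Φ x.1 x.2) (hinj : Function.Injective (Φ c₀))
    (hid : ∀ᶠ c in 𝓝 c₀, ∀ y ∉ K, Φ c y = y) (z : N) :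
    ContMDiffAt (𝓘(ℝ, G).prod I) I ∞ (fun x : G × N => extendByIdentity ψ (Φ x.1) x.2) (c₀, z) := by
  by_cases hz : z ∈ ψ.source
  · have hmem : Φ c₀ (ψ z) ∈ ψ.target :=
      mapsTo_of_injective_of_eq_self_off hinj hKψ hid.self_of_nhds (ψ.map_source hz)
    have hψz : ContMDiffAt (𝓘(ℝ, G).prod I) 𝓘(ℝ, G × F) ∞ (fun x : G × N => (x.1, ψ x.2)) (c₀, z) :=
      contMDiffAt_fst.prodMk_space
        ((hψ.contMDiffAt (ψ.open_source.mem_nhds hz)).comp (c₀, z) contMDiffAt_snd)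
    have hΦz := (hΦ.contMDiff.contMDiffAt (x := (c₀, ψ z))).comp (c₀, z) hψz
    have hsymm := (hψsymm.contMDiffAt (ψ.open_target.mem_nhds hmem)).comp (c₀, z) hΦz
    refine hsymm.congr_of_eventuallyEq ?_
    filter_upwards [continuous_snd.continuousAt.eventually (ψ.open_source.mem_nhds hz)] with x hx
    exact extendByIdentity_of_mem hx
  · refine contMDiffAt_snd.congr_of_eventuallyEq ?_
    filter_upwards [hid.prod_nhds (compl_image_symm_mem_nhds hK hKψ hz)] with x hx
    exact extendByIdentity_eq_self hx.1 hx.2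

lemma contMDiff_extendByIdentity (hψ : ContMDiffOn I 𝓘(ℝ, F) ∞ ψ ψ.source)
    (hψsymm : ContMDiffOn 𝓘(ℝ, F) I ∞ ψ.symm ψ.target) (hK : IsCompact K) (hKψ : K ⊆ ψ.target)
    {Φ : F → F} (hΦ : ContDiff ℝ ∞ Φ) (hinj : Function.Injective Φ) (hid : ∀ y ∉ K, Φ y = y) :
    ContMDiff I I ∞ (extendByIdentity ψ Φ) := fun z =>
  (contMDiffAt_extendByIdentity hψ hψsymm hK hKψ (Φ := fun _ : ℝ => Φ) (c₀ := 0)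
    (hΦ.comp contDiff_snd) hinj (Eventually.of_forall fun _ => hid) z).comp z
    (contMDiffAt_const.prodMk contMDiffAt_id)

lemma exists_diffeomorph_eq_extendByIdentity (hψ : ContMDiffOn I 𝓘(ℝ, F) ∞ ψ ψ.source)
    (hψsymm : ContMDiffOn 𝓘(ℝ, F) I ∞ ψ.symm ψ.target) (hK : IsCompact K) (hKψ : K ⊆ ψ.target)
    (Φ : F ≃ₘ^∞⟮𝓘(ℝ, F), 𝓘(ℝ, F)⟯ F) (hid : ∀ y ∉ K, Φ y = y) :
    ∃ e : N ≃ₘ^∞⟮I, I⟯ N, ⇑e = extendByIdentity ψ Φ := by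
  have hid_symm : ∀ y ∉ K, Φ.symm y = y := fun y hy => by
    rw [← hid y hy, Φ.symm_apply_apply, hid y hy]
  have hmaps := mapsTo_of_injective_of_eq_self_off Φ.injective hKψ hid
  have hmaps_symm := mapsTo_of_injective_of_eq_self_off Φ.symm.injective hKψ hid_symm
  exact ⟨{
    toFun := extendByIdentity ψ Φ
    invFun := extendByIdentity ψ Φ.symm
    left_inv := extendByIdentity_extendByIdentity hmaps Φ.symm_apply_apply
    right_inv := extendByIdentity_extendByIdentity hmaps_symm Φ.apply_symm_apply
    contMDiff_toFun :=
      contMDiff_extendByIdentity hψ hψsymm hK hKψ Φ.contMDiff.contDiff Φ.injective hid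
    contMDiff_invFun :=
      contMDiff_extendByIdentity hψ hψsymm hK hKψ Φ.symm.contMDiff.contDiff Φ.symm.injective
        hid_symm }, rfl⟩

end SmoothExtension

section Immersion

variable {𝕜 : Type*} [NontriviallyNormedField 𝕜]
  {E : Type*} [NormedAddCommGroup E] [NormedSpace 𝕜 E]
  {H : Type*} [TopologicalSpace H] {I : ModelWithCorners 𝕜 E H}
  {P : Type*} [TopologicalSpace P] [ChartedSpace H P]
  {E' : Type*} [NormedAddCommGroup E'] [NormedSpace 𝕜 E']
  {H' : Type*} [TopologicalSpace H'] {I' : ModelWithCorners 𝕜 E' H'}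
  {N : Type*} [TopologicalSpace N] [ChartedSpace H' N]
  {N' : Type*} [TopologicalSpace N'] [ChartedSpace H' N']
  {m : ℕ∞ω} [IsManifold I' m N'] {f : P → N}

lemma isImmersionAtOfComplement_diffeomorph_comp {F : Type*} [NormedAddCommGroup F]
    [NormedSpace 𝕜 F] {q : P} (e : N ≃ₘ^m⟮I', I'⟯ N')
    (hf : Manifold.IsImmersionAtOfComplement F I I' m f q) :
    Manifold.IsImmersionAtOfComplement F I I' m (e ∘ f) q := by
  refine .mk_of_continuousAt (e.continuous.continuousAt.comp hf.continuousAt) hf.equiv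
    hf.domChart (e.symm.toHomeomorph.transOpenPartialHomeomorph hf.codChart)
    hf.mem_domChart_source ?_ hf.domChart_mem_maximalAtlas ?_ fun y hy => ?_
  · simpa using hf.mem_codChart_source
  · exact OpenPartialHomeomorph.mem_maximalAtlas_of_contMDiffOn _
      ((contMDiffOn_of_mem_maximalAtlas hf.codChart_mem_maximalAtlas).comp
        e.symm.contMDiff.contMDiffOn fun _ => id)
      (e.contMDiff.comp_contMDiffOn
        (contMDiffOn_symm_of_mem_maximalAtlas hf.codChart_mem_maximalAtlas))
  · rw [← hf.writtenInCharts hy]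
    simp

lemma isSmoothEmbedding_diffeomorph_comp (e : N ≃ₘ^m⟮I', I'⟯ N')
    (hf : Manifold.IsSmoothEmbedding I I' m f) : Manifold.IsSmoothEmbedding I I' m (e ∘ f) := by
  obtain ⟨F, _, _, hF⟩ := hf.isImmersion
  exact ⟨⟨F, _, _, fun q => isImmersionAtOfComplement_diffeomorph_comp e (hF q)⟩,
    e.toHomeomorph.isEmbedding.comp hf.isEmbedding⟩

end Immersion

section CotangentLift

variable {E : Type*} [NormedAddCommGroup E] [NormedSpace ℝ E]

/-- The canonical symplectic form `dx^i ∧ dp_i` of the product of a normed space and its dual. -/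
def canonicalForm (u v : E × (E →L[ℝ] ℝ)) : ℝ := v.2 u.1 - u.2 v.1

variable {E' : Type*} [NormedAddCommGroup E'] [NormedSpace ℝ E']

/-- The cotangent lift `(x, p) ↦ (τ x, p ∘ (dτ_x)⁻¹)` of the local diffeomorphism `τ` with inverse
`σ`. -/
def cotangentLift (τ : E → E') (σ : E' → E) (q : E × (E →L[ℝ] ℝ)) : E' × (E' →L[ℝ] ℝ) :=
  (τ q.1, q.2 ∘L fderiv ℝ σ (τ q.1))

variable {τ : E → E'} {σ : E' → E} {x : E}

lemma eventually_fderiv_comp_fderiv_of_leftInverse (hτ : ContDiffAt ℝ 1 τ x)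
    (hσ : ContDiffAt ℝ 1 σ (τ x)) (hστ : ∀ᶠ y in 𝓝 x, σ (τ y) = y) :
    ∀ᶠ y in 𝓝 x, fderiv ℝ σ (τ y) ∘L fderiv ℝ τ y = ContinuousLinearMap.id ℝ E := by
  filter_upwards [hστ.eventually_nhds, hτ.eventually (by simp),
    hτ.continuousAt.eventually (hσ.eventually (by simp))] with y hy hτy hσy
  rw [← fderiv_comp y (hσy.differentiableAt (by simp)) (hτy.differentiableAt (by simp))]
  exact (Filter.EventuallyEq.fderiv_eq hy).trans fderiv_id

lemma fderiv_fderiv_comp_of_leftInverse (hτ : ContDiffAt ℝ 2 τ x) (hσ : ContDiffAt ℝ 2 σ (τ x))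
    (hστ : ∀ᶠ y in 𝓝 x, σ (τ y) = y) (u v : E) :
    fderiv ℝ (fun y => fderiv ℝ σ (τ y)) x u (fderiv ℝ τ x v) =
      -fderiv ℝ σ (τ x) (fderiv ℝ (fderiv ℝ τ) x u v) := by
  have hdτ : DifferentiableAt ℝ (fderiv ℝ τ) x :=
    (hτ.fderiv_right (m := 1) le_rfl).differentiableAt (by simp)
  have hdσ : DifferentiableAt ℝ (fun y => fderiv ℝ σ (τ y)) x :=
    ((hσ.fderiv_right (m := 1) le_rfl).differentiableAt (by simp)).comp x
      (hτ.differentiableAt (by simp))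
  have hconst := eventually_fderiv_comp_fderiv_of_leftInverse (hτ.of_le (by simp))
    (hσ.of_le (by simp)) hστ
  have hzero := (hdσ.hasFDerivAt.clm_comp hdτ.hasFDerivAt).unique
    ((hasFDerivAt_const _ x).congr_of_eventuallyEq hconst)
  have := DFunLike.congr_fun (DFunLike.congr_fun hzero u) v
  rw [eq_neg_iff_add_eq_zero, add_comm]
  simpa using this

lemma fderiv_cotangentLift (hτ : DifferentiableAt ℝ τ x)
    (hσ : DifferentiableAt ℝ (fun y => fderiv ℝ σ (τ y)) x) (p : E →L[ℝ] ℝ)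
    (a : E × (E →L[ℝ] ℝ)) :
    fderiv ℝ (cotangentLift τ σ) (x, p) a = (fderiv ℝ τ x a.1,
      a.2 ∘L fderiv ℝ σ (τ x) + p ∘L fderiv ℝ (fun y => fderiv ℝ σ (τ y)) x a.1) := by
  have hfst : HasFDerivAt (fun q : E × (E →L[ℝ] ℝ) => τ q.1) (fderiv ℝ τ x ∘L .fst ℝ _ _) (x, p) :=
    HasFDerivAt.comp (x, p) hτ.hasFDerivAt hasFDerivAt_fst
  have hsnd : HasFDerivAt (fun q : E × (E →L[ℝ] ℝ) => fderiv ℝ σ (τ q.1))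
      (fderiv ℝ (fun y => fderiv ℝ σ (τ y)) x ∘L .fst ℝ _ _) (x, p) :=
    HasFDerivAt.comp (x, p) (g := fun y => fderiv ℝ σ (τ y)) hσ.hasFDerivAt hasFDerivAt_fst
  have h := hfst.prodMk ((hasFDerivAt_snd (p := (x, p))).clm_comp hsnd)
  rw [show fderiv ℝ (cotangentLift τ σ) (x, p) = _ from h.fderiv]
  refine Prod.ext rfl ?_
  simp [add_comm]

lemma canonicalForm_fderiv_cotangentLift (hτ : ContDiffAt ℝ 2 τ x) (hσ : ContDiffAt ℝ 2 σ (τ x))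
    (hστ : ∀ᶠ y in 𝓝 x, σ (τ y) = y) (p : E →L[ℝ] ℝ) (a b : E × (E →L[ℝ] ℝ)) :
    canonicalForm (fderiv ℝ (cotangentLift τ σ) (x, p) a)
      (fderiv ℝ (cotangentLift τ σ) (x, p) b) = canonicalForm a b := by
  have hdσ : DifferentiableAt ℝ (fun y => fderiv ℝ σ (τ y)) x :=
    ((hσ.fderiv_right (m := 1) le_rfl).differentiableAt (by simp)).comp x
      (hτ.differentiableAt (by simp))
  have hinv (v : E) : fderiv ℝ σ (τ x) (fderiv ℝ τ x v) = v :=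
    DFunLike.congr_fun (eventually_fderiv_comp_fderiv_of_leftInverse (hτ.of_le (by simp))
      (hσ.of_le (by simp)) hστ).self_of_nhds v
  have hsymm : IsSymmSndFDerivAt ℝ τ x :=
    hτ.isSymmSndFDerivAt (by simp [minSmoothness_of_isRCLikeNormedField])
  rw [fderiv_cotangentLift (hτ.differentiableAt (by simp)) hdσ,
    fderiv_cotangentLift (hτ.differentiableAt (by simp)) hdσ]
  simp only [canonicalForm, add_apply, ContinuousLinearMap.comp_apply, hinv,
    fderiv_fderiv_comp_of_leftInverse hτ hσ hστ, hsymm b.1 a.1]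
  ring

end CotangentLift

lemma t2Space_totalSpace {B : Type*} [TopologicalSpace B] [T2Space B] (F : Type*)
    [TopologicalSpace F] [T2Space F] (V : B → Type*) [∀ b, TopologicalSpace (V b)]
    [TopologicalSpace (Bundle.TotalSpace F V)] [FiberBundle F V] :
    T2Space (Bundle.TotalSpace F V) := by
  refine ⟨fun z w hzw => ?_⟩
  by_cases h : z.proj = w.proj
  · let e := (trivializationAt F V z.proj).toOpenPartialHomeomorph
    have hz : z ∈ e.source := FiberBundle.mem_trivializationAt_proj_source
    have hw : w ∈ e.source := by
      rw [Bundle.Trivialization.mem_source, ← h]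
      exact FiberBundle.mem_baseSet_trivializationAt F V z.proj
    obtain ⟨u, v, hu, hv, hzu, hwv, huv⟩ := t2_separation fun h => hzw (e.injOn hz hw h)
    exact ⟨e.source ∩ e ⁻¹' u, e.source ∩ e ⁻¹' v, e.isOpen_inter_preimage hu,
      e.isOpen_inter_preimage hv, ⟨hz, hzu⟩, ⟨hw, hwv⟩,
      (huv.preimage e).mono inter_subset_right inter_subset_right⟩
  · exact separated_by_continuous (FiberBundle.continuous_proj F V) h

section TransitionMap

variable {E : Type*} [NormedAddCommGroup E] [NormedSpace ℝ E]
  {H : Type*} [TopologicalSpace H] {I : ModelWithCorners ℝ E H}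
  {M : Type*} [TopologicalSpace M] [ChartedSpace H M] {a b x : M}

variable (I) in
/-- The coordinate change from the chart at `a` to the chart at `b`. -/
def transitionMap (a b : M) : E → E :=
  extChartAt I b ∘ (extChartAt I a).symm

lemma transitionMap_apply (ha : x ∈ (extChartAt I a).source) :
    transitionMap I a b (extChartAt I a x) = extChartAt I b x := by
  rw [transitionMap, Function.comp_apply, (extChartAt I a).left_inv ha]

variable [I.Boundaryless]

lemma eventually_transitionMap_transitionMap (ha : x ∈ (extChartAt I a).source)
    (hb : x ∈ (extChartAt I b).source) :
    ∀ᶠ y in 𝓝 (extChartAt I a x), transitionMap I b a (transitionMap I a b y) = y := by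
  have hsymm : ∀ᶠ y in 𝓝 (extChartAt I a x),
      (extChartAt I a).symm y ∈ (extChartAt I b).source :=
    (continuousAt_extChartAt_symm' ha).eventually
      (by rw [(extChartAt I a).left_inv ha]; exact extChartAt_source_mem_nhds' hb)
  filter_upwards [extChartAt_target_mem_nhds' ((extChartAt I a).map_source ha), hsymm]
    with y hy hyb
  simp only [transitionMap, Function.comp_apply]
  rw [(extChartAt I b).left_inv hyb, (extChartAt I a).right_inv hy]

lemma contDiffAt_transitionMap [IsManifold I ∞ M] (ha : x ∈ (extChartAt I a).source)
    (hb : x ∈ (extChartAt I b).source) :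
    ContDiffAt ℝ ∞ (transitionMap I a b) (extChartAt I a x) := by
  have h := contDiffWithinAt_ext_coord_change (I := I) (n := ∞) b a (y := extChartAt I a x)
    ⟨(extChartAt I a).map_source ha, by
      rwa [mem_preimage, PartialEquiv.symm_symm, (extChartAt I a).left_inv ha]⟩
  rwa [I.range_eq_univ, contDiffWithinAt_univ] at h

lemma fderiv_transitionMap [IsManifold I 1 M] (a b x : M) :
    fderiv ℝ (transitionMap I a b) (extChartAt I a x) = tangentCoordChange I a b x := by
  rw [tangentCoordChange_def, I.range_eq_univ, fderivWithin_univ, transitionMap]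

end TransitionMap

section CanonicalCoordinates

variable {n : ℕ} {M : Type*} [TopologicalSpace M] [ChartedSpace (RSpace n) M]
  [IsManifold (𝓡 n) ∞ M]

lemma mem_cotangent_extChartAt_source {z w : CotangentBundle n M} :
    z ∈ (extChartAt (cotangentModel n) w).source ↔
      z.proj ∈ (extChartAt (𝓡 n) w.proj).source := by
  rw [FiberBundle.extChartAt]
  have h : z ∈ (trivializationAt (RDual n)
      (fun x : M => TangentSpace (𝓡 n) x →L[ℝ] Bundle.Trivial M ℝ x) w.proj).source ↔
      z.proj ∈ (chartAt (RSpace n) w.proj).source := by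
    rw [hom_trivializationAt_source]
    exact ⟨fun h => h.1, fun h => ⟨h, mem_univ _⟩⟩
  rw [PartialEquiv.trans_source, mem_inter_iff, h, extChartAt_source]
  refine and_iff_left_of_imp fun hz => ⟨?_, mem_univ _⟩
  rw [extChartAt_source]
  exact hz

lemma cotangent_extChartAt_apply {z w : CotangentBundle n M}
    (hz : z ∈ (extChartAt (cotangentModel n) w).source) :
    extChartAt (cotangentModel n) w z =
      (extChartAt (𝓡 n) w.proj z.proj,
        (z.2 : RDual n) ∘L tangentCoordChange (𝓡 n) w.proj z.proj z.proj) := by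
  have hz' := mem_cotangent_extChartAt_source.1 hz
  rw [extChartAt_source] at hz'
  have h := hom_chart (HB := RSpace n) (𝕜 := ℝ) w z
  rw [ContinuousLinearMap.inCoordinates, TangentBundle.symmL_trivializationAt_eq_core hz'] at h
  refine h.trans (Prod.ext rfl ?_)
  ext v
  simp [Bundle.Trivial.continuousLinearMapAt_trivialization]

lemma cotangent_transition_eq_cotangentLift {y z w : CotangentBundle n M}
    (hz : y ∈ (extChartAt (cotangentModel n) z).source)
    (hw : y ∈ (extChartAt (cotangentModel n) w).source) :
    extChartAt (cotangentModel n) w y =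
      cotangentLift (transitionMap (𝓡 n) z.proj w.proj) (transitionMap (𝓡 n) w.proj z.proj)
        (extChartAt (cotangentModel n) z y) := by
  have hz' := mem_cotangent_extChartAt_source.1 hz
  have hw' := mem_cotangent_extChartAt_source.1 hw
  rw [cotangent_extChartAt_apply hz, cotangent_extChartAt_apply hw, cotangentLift,
    transitionMap_apply hz', fderiv_transitionMap]
  refine Prod.ext rfl (ContinuousLinearMap.ext fun v => congrArg (y.2 : RDual n) ?_)
  exact (tangentCoordChange_comp ⟨⟨hw', hz'⟩, mem_extChartAt_source _⟩).symm

lemma mfderiv_cotangent_extChartAt {z w : CotangentBundle n M}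
    (hz : z ∈ (extChartAt (cotangentModel n) w).source) :
    mfderiv (cotangentModel n) 𝓘(ℝ, RSpace n × RDual n) (extChartAt (cotangentModel n) w) z =
      fderiv ℝ
        (cotangentLift (transitionMap (𝓡 n) z.proj w.proj) (transitionMap (𝓡 n) w.proj z.proj))
        (extChartAt (cotangentModel n) z z) := by
  have hd : MDifferentiableAt (cotangentModel n) 𝓘(ℝ, RSpace n × RDual n)
      (extChartAt (cotangentModel n) w) z :=
    (contMDiffAt_extChartAt' (n := 1)
      (by rwa [← extChartAt_source (cotangentModel n)])).mdifferentiableAt (by simp)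
  have hsymm : ∀ᶠ q in 𝓝 (extChartAt (cotangentModel n) z z),
      (extChartAt (cotangentModel n) z).symm q ∈ (extChartAt (cotangentModel n) w).source :=
    (continuousAt_extChartAt_symm z).eventually
      (by rw [extChartAt_to_inv]; exact extChartAt_source_mem_nhds' hz)
  have hlift : extChartAt (cotangentModel n) w ∘ (extChartAt (cotangentModel n) z).symm
      =ᶠ[𝓝 (extChartAt (cotangentModel n) z z)]
      cotangentLift (transitionMap (𝓡 n) z.proj w.proj) (transitionMap (𝓡 n) w.proj z.proj) := by
    filter_upwards [extChartAt_target_mem_nhds z, hsymm] with q hq hqw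
    have h := cotangent_transition_eq_cotangentLift
      ((extChartAt (cotangentModel n) z).map_target hq) hqw
    rwa [(extChartAt (cotangentModel n) z).right_inv hq] at h
  rw [hd.mfderiv, ← hlift.fderiv_eq, ModelWithCorners.range_eq_univ, fderivWithin_univ]
  rfl

lemma canonicalForm_mfderiv_extChartAt {z w : CotangentBundle n M}
    (hz : z ∈ (extChartAt (cotangentModel n) w).source)
    (u v : TangentSpace (cotangentModel n) z) :
    canonicalForm (mfderiv (cotangentModel n) 𝓘(ℝ, RSpace n × RDual n)
        (extChartAt (cotangentModel n) w) z u)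
      (mfderiv (cotangentModel n) 𝓘(ℝ, RSpace n × RDual n)
        (extChartAt (cotangentModel n) w) z v) = symplecticForm z u v := by
  have hzz : z.proj ∈ (extChartAt (𝓡 n) z.proj).source := mem_extChartAt_source _
  have hzw := mem_cotangent_extChartAt_source.1 hz
  have hτ := contDiffAt_transitionMap hzz hzw
  have hσ := contDiffAt_transitionMap hzw hzz
  rw [← transitionMap_apply hzz] at hσ
  rw [mfderiv_cotangent_extChartAt hz, cotangent_extChartAt_apply (mem_extChartAt_source z)]
  exact canonicalForm_fderiv_cotangentLift (hτ.of_le ENat.LEInfty.out)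
    (hσ.of_le ENat.LEInfty.out) (eventually_transitionMap_transitionMap hzz hzw) _ u v

end CanonicalCoordinates

section ComplexCoordinates

variable {ι : Type*} [Fintype ι]

variable (ι) in
/-- The identification of `ℝ^ι × (ℝ^ι)^*` with `ℂ^ι` by the complex coordinates `x_k + i p_k`. -/
def complexCoordinates :
    (EuclideanSpace ℝ ι × (EuclideanSpace ℝ ι →L[ℝ] ℝ)) ≃L[ℝ] EuclideanSpace ℂ ι :=
  LinearEquiv.toContinuousLinearEquiv
    { toFun q := WithLp.toLp 2 fun k =>
        ⟨q.1 k, (InnerProductSpace.toDual ℝ (EuclideanSpace ℝ ι)).symm q.2 k⟩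
      invFun z := (WithLp.toLp 2 fun k => (z k).re,
        InnerProductSpace.toDual ℝ _ (WithLp.toLp 2 fun k => (z k).im))
      left_inv q := by simp
      right_inv z := by ext k; simp
      map_add' q q' := by ext k; simp [Complex.ext_iff]
      map_smul' s q := by ext k; simp [Complex.ext_iff] }

lemma complexCoordinates_apply (q : EuclideanSpace ℝ ι × (EuclideanSpace ℝ ι →L[ℝ] ℝ)) (k : ι) :
    complexCoordinates ι q k =
      ⟨q.1 k, (InnerProductSpace.toDual ℝ (EuclideanSpace ℝ ι)).symm q.2 k⟩ :=
  rfl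

lemma im_inner_complexCoordinates (u v : EuclideanSpace ℝ ι × (EuclideanSpace ℝ ι →L[ℝ] ℝ)) :
    (inner ℂ (complexCoordinates ι u) (complexCoordinates ι v)).im = canonicalForm u v := by
  have hdual (p : EuclideanSpace ℝ ι →L[ℝ] ℝ) (x : EuclideanSpace ℝ ι) :
      p x = ∑ k, x k * (InnerProductSpace.toDual ℝ (EuclideanSpace ℝ ι)).symm p k := by
    conv_lhs => rw [← InnerProductSpace.toDual_symm_apply (𝕜 := ℝ), PiLp.inner_apply]
    rfl
  rw [canonicalForm, hdual, hdual, ← Finset.sum_sub_distrib, PiLp.inner_apply, Complex.im_sum]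
  refine Finset.sum_congr rfl fun k _ => ?_
  simp only [complexCoordinates_apply, RCLike.inner_apply, Complex.mul_im, Complex.conj_re,
    Complex.conj_im]
  ring

end ComplexCoordinates

section DarbouxChart

variable {n : ℕ} {M : Type*} [TopologicalSpace M] [ChartedSpace (RSpace n) M]
  [IsManifold (𝓡 n) ∞ M]

/-- The Darboux chart `(x_k + i p_k)` of `T^*M` that belongs to the chart of `M` at the base point
of `w`. -/
def darbouxChart (w : CotangentBundle n M) :
    OpenPartialHomeomorph (CotangentBundle n M) (EuclideanSpace ℂ (Fin n)) :=
  OpenPartialHomeomorph.transHomeomorph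
    { toPartialEquiv := extChartAt (cotangentModel n) w
      open_source := isOpen_extChartAt_source w
      open_target := isOpen_extChartAt_target w
      continuousOn_toFun := continuousOn_extChartAt w
      continuousOn_invFun := continuousOn_extChartAt_symm w }
    (complexCoordinates (Fin n)).toHomeomorph

lemma coe_darbouxChart (w : CotangentBundle n M) :
    ⇑(darbouxChart w) = complexCoordinates (Fin n) ∘ extChartAt (cotangentModel n) w :=
  rfl

lemma darbouxChart_source (w : CotangentBundle n M) :
    (darbouxChart w).source = (extChartAt (cotangentModel n) w).source :=
  rfl

lemma mem_darbouxChart_source (w : CotangentBundle n M) : w ∈ (darbouxChart w).source :=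
  mem_extChartAt_source w

lemma contMDiffOn_darbouxChart (w : CotangentBundle n M) :
    ContMDiffOn (cotangentModel n) 𝓘(ℝ, EuclideanSpace ℂ (Fin n)) ∞ (darbouxChart w)
      (darbouxChart w).source := by
  rw [darbouxChart_source, extChartAt_source]
  exact (complexCoordinates (Fin n)).contDiff.contMDiff.comp_contMDiffOn contMDiffOn_extChartAt

lemma contMDiffOn_darbouxChart_symm (w : CotangentBundle n M) :
    ContMDiffOn 𝓘(ℝ, EuclideanSpace ℂ (Fin n)) (cotangentModel n) ∞ (darbouxChart w).symm
      (darbouxChart w).target :=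
  (contMDiffOn_extChartAt_symm w).comp
    (complexCoordinates (Fin n)).symm.contDiff.contMDiff.contMDiffOn fun _ hy => hy

lemma mdifferentiableAt_darbouxChart {w z : CotangentBundle n M}
    (hz : z ∈ (darbouxChart w).source) :
    MDifferentiableAt (cotangentModel n) 𝓘(ℝ, EuclideanSpace ℂ (Fin n)) (darbouxChart w) z :=
  ((contMDiffOn_darbouxChart w).contMDiffAt
    ((darbouxChart w).open_source.mem_nhds hz)).mdifferentiableAt (by simp)

lemma im_inner_mfderiv_darbouxChart {w z : CotangentBundle n M}
    (hz : z ∈ (darbouxChart w).source) (u v : TangentSpace (cotangentModel n) z) :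
    (inner ℂ (E := EuclideanSpace ℂ (Fin n))
      (mfderiv (cotangentModel n) 𝓘(ℝ, EuclideanSpace ℂ (Fin n)) (darbouxChart w) z u)
      (mfderiv (cotangentModel n) 𝓘(ℝ, EuclideanSpace ℂ (Fin n)) (darbouxChart w) z v)).im =
        symplecticForm z u v := by
  have hd : MDifferentiableAt (cotangentModel n) 𝓘(ℝ, RSpace n × RDual n)
      (extChartAt (cotangentModel n) w) z :=
    (contMDiffAt_extChartAt' (n := 1)
      (by rwa [← extChartAt_source (cotangentModel n)])).mdifferentiableAt (by simp)
  have hL : MDifferentiableAt 𝓘(ℝ, RSpace n × RDual n) 𝓘(ℝ, EuclideanSpace ℂ (Fin n))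
      (complexCoordinates (Fin n)) (extChartAt (cotangentModel n) w z) :=
    (complexCoordinates (Fin n)).differentiableAt.mdifferentiableAt
  have hchain := mfderiv_comp z hL hd
  rw [mfderiv_eq_fderiv, ContinuousLinearEquiv.fderiv, ← coe_darbouxChart] at hchain
  exact (congrArg₂ (fun a b : EuclideanSpace ℂ (Fin n) => (inner ℂ a b).im)
    (DFunLike.congr_fun hchain u) (DFunLike.congr_fun hchain v)).trans <|
      (im_inner_complexCoordinates _ _).trans (canonicalForm_mfderiv_extChartAt hz u v)

end DarbouxChart

section Symplectomorphism

variable {n : ℕ} {M : Type*} [TopologicalSpace M] [ChartedSpace (RSpace n) M]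
  [IsManifold (𝓡 n) ∞ M]

instance instT2SpaceCotangentBundle [T2Space M] : T2Space (CotangentBundle n M) :=
  t2Space_totalSpace (RDual n) _

/-- `Φ` is a diffeomorphism of `T^*M` that preserves the symplectic form. -/
structure IsSymplectomorphism (Φ : CotangentBundle n M → CotangentBundle n M) : Prop where
  exists_diffeomorph : ∃ e : CotangentBundle n M ≃ₘ^∞⟮cotangentModel n, cotangentModel n⟯
    CotangentBundle n M, ⇑e = Φ
  symplecticForm_mfderiv : ∀ z (u v : TangentSpace (cotangentModel n) z),
    symplecticForm (Φ z) (mfderiv (cotangentModel n) (cotangentModel n) Φ z u)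
      (mfderiv (cotangentModel n) (cotangentModel n) Φ z v) = symplecticForm z u v

lemma IsSymplectomorphism.contMDiff {Φ : CotangentBundle n M → CotangentBundle n M}
    (hΦ : IsSymplectomorphism Φ) : ContMDiff (cotangentModel n) (cotangentModel n) ∞ Φ := by
  obtain ⟨e, rfl⟩ := hΦ.exists_diffeomorph
  exact e.contMDiff

lemma IsSymplectomorphism.comp_isLagrangianEmbedding {P : Type*} [TopologicalSpace P]
    [ChartedSpace (RSpace n) P] {Φ : CotangentBundle n M → CotangentBundle n M}
    (hΦ : IsSymplectomorphism Φ) {i : P → CotangentBundle n M} (hi : IsLagrangianEmbedding i) :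
    IsLagrangianEmbedding (Φ ∘ i) := by
  obtain ⟨e, he⟩ := hΦ.exists_diffeomorph
  refine ⟨he ▸ isSmoothEmbedding_diffeomorph_comp e hi.isSmoothEmbedding, fun q u v => ?_⟩
  rw [mfderiv_comp q (hΦ.contMDiff.mdifferentiable (by simp) _)
    (hi.isSmoothEmbedding.contMDiff.mdifferentiable (by simp) q)]
  exact (hΦ.symplecticForm_mfderiv (i q) _ _).trans (hi.isotropic q u v)

lemma symplecticForm_mfderiv_of_conj {w z : CotangentBundle n M}
    {Ψ : CotangentBundle n M → CotangentBundle n M}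
    {Φ : EuclideanSpace ℂ (Fin n) → EuclideanSpace ℂ (Fin n)}
    (hz : z ∈ (darbouxChart w).source) (hΨz : Ψ z ∈ (darbouxChart w).source)
    (hΨ : MDifferentiableAt (cotangentModel n) (cotangentModel n) Ψ z)
    (hΦ : DifferentiableAt ℝ Φ (darbouxChart w z))
    (hconj : darbouxChart w ∘ Ψ =ᶠ[𝓝 z] Φ ∘ darbouxChart w)
    (hΦform : ∀ u v, (inner ℂ (fderiv ℝ Φ (darbouxChart w z) u)
      (fderiv ℝ Φ (darbouxChart w z) v)).im = (inner ℂ u v).im)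
    (u v : TangentSpace (cotangentModel n) z) :
    symplecticForm (Ψ z) (mfderiv (cotangentModel n) (cotangentModel n) Ψ z u)
      (mfderiv (cotangentModel n) (cotangentModel n) Ψ z v) = symplecticForm z u v := by
  have hderiv := hconj.mfderiv_eq (I := cotangentModel n) (I' := 𝓘(ℝ, EuclideanSpace ℂ (Fin n)))
  rw [mfderiv_comp z (mdifferentiableAt_darbouxChart hΨz) hΨ,
    mfderiv_comp z hΦ.mdifferentiableAt (mdifferentiableAt_darbouxChart hz),
    mfderiv_eq_fderiv] at hderiv
  rw [← im_inner_mfderiv_darbouxChart hΨz, ← im_inner_mfderiv_darbouxChart hz]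
  exact (congrArg₂ (fun a b : EuclideanSpace ℂ (Fin n) => (inner ℂ a b).im)
    (DFunLike.congr_fun hderiv u) (DFunLike.congr_fun hderiv v)).trans (hΦform _ _)

variable [T2Space M] {w : CotangentBundle n M}
  {Φ : EuclideanSpace ℂ (Fin n) ≃ₘ^∞⟮𝓘(ℝ, EuclideanSpace ℂ (Fin n)),
    𝓘(ℝ, EuclideanSpace ℂ (Fin n))⟯ EuclideanSpace ℂ (Fin n)}
  {K : Set (EuclideanSpace ℂ (Fin n))}

lemma isSymplectomorphism_extendByIdentity (hK : IsCompact K) (hKw : K ⊆ (darbouxChart w).target)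
    (hid : ∀ y ∉ K, Φ y = y)
    (hΦ : ∀ y u v, (inner ℂ (fderiv ℝ Φ y u) (fderiv ℝ Φ y v)).im = (inner ℂ u v).im) :
    IsSymplectomorphism (extendByIdentity (darbouxChart w) Φ) := by
  set ψ := darbouxChart w
  set Ψ := extendByIdentity ψ Φ with hΨ
  have hmaps := mapsTo_of_injective_of_eq_self_off Φ.injective hKw hid
  obtain ⟨e, he⟩ := exists_diffeomorph_eq_extendByIdentity (contMDiffOn_darbouxChart w)
    (contMDiffOn_darbouxChart_symm w) hK hKw Φ hid
  have hΨsmooth : MDifferentiable (cotangentModel n) (cotangentModel n) Ψ := by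
    rw [hΨ, ← he]
    exact e.contMDiff.mdifferentiable (by simp)
  refine ⟨⟨e, he⟩, fun z u v => ?_⟩
  by_cases hz : z ∈ ψ.source
  · have hΨz : Ψ z ∈ ψ.source := by
      rw [hΨ, extendByIdentity_of_mem hz]
      exact ψ.map_target (hmaps (ψ.map_source hz))
    exact symplecticForm_mfderiv_of_conj hz hΨz (hΨsmooth z)
      (Φ.contMDiff.contDiff.differentiable (by simp) _)
      (eventually_chart_extendByIdentity hmaps hz) (hΦ (ψ z)) u v
  · have hΨid : Ψ =ᶠ[𝓝 z] id := by
      filter_upwards [compl_image_symm_mem_nhds hK hKw hz] with y hy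
      exact extendByIdentity_eq_self hid hy
    have hderiv := hΨid.mfderiv_eq (I := cotangentModel n) (I' := cotangentModel n)
    rw [mfderiv_id] at hderiv
    exact congrArg₂ (symplecticForm z) (DFunLike.congr_fun hderiv u) (DFunLike.congr_fun hderiv v)

end Symplectomorphism

section DarbouxTranslation

variable {n : ℕ} {M : Type*} [TopologicalSpace M] [ChartedSpace (RSpace n) M]
  [IsManifold (𝓡 n) ∞ M] {w z : CotangentBundle n M} {r : ℝ} {c : EuclideanSpace ℂ (Fin n)}

/-- The local translation by `2 c` in the Darboux chart at `w`, extended to `T^*M` by the identity.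
It moves only points that have distance at most `r + ‖c‖` from `w` in that chart. -/
def darbouxTranslation (w : CotangentBundle n M) (r : ℝ) (c : EuclideanSpace ℂ (Fin n)) :
    CotangentBundle n M → CotangentBundle n M :=
  extendByIdentity (darbouxChart w) (localTranslation r (darbouxChart w w) c)

lemma darbouxTranslation_zero (w : CotangentBundle n M) (r : ℝ) :
    darbouxTranslation w r 0 = id := by
  rw [← extendByIdentity_id (darbouxChart w), darbouxTranslation]
  exact congrArg _ (funext (localTranslation_zero r _))

lemma darbouxTranslation_eq_self (hr : 0 < r) (hc : ‖c‖ ≤ r)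
    (hz : z ∉ (darbouxChart w).symm '' Metric.closedBall (darbouxChart w w) (2 * r)) :
    darbouxTranslation w r c z = z :=
  extendByIdentity_eq_self (fun _ => localTranslation_eq_self_of_norm_le hr hc) hz

lemma isSymplectomorphism_darbouxTranslation [T2Space M] (hr : 0 < r) (hc : ‖c‖ ≤ r)
    (hball : Metric.closedBall (darbouxChart w w) (2 * r) ⊆ (darbouxChart w).target) :
    IsSymplectomorphism (darbouxTranslation w r c) :=
  isSymplectomorphism_extendByIdentity (isCompact_closedBall _ _) hball
    (fun _ => localTranslation_eq_self_of_norm_le hr hc)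
    (im_inner_fderiv_localTranslation r _ c)

lemma contMDiffAt_darbouxTranslation [T2Space M] (hr : 0 < r)
    (hball : Metric.closedBall (darbouxChart w w) (2 * r) ⊆ (darbouxChart w).target)
    (z : CotangentBundle n M) :
    ContMDiffAt (𝓘(ℝ, EuclideanSpace ℂ (Fin n)).prod (cotangentModel n)) (cotangentModel n) ∞
      (fun x : EuclideanSpace ℂ (Fin n) × CotangentBundle n M => darbouxTranslation w r x.1 x.2)
      (0, z) := by
  refine contMDiffAt_extendByIdentity (Φ := fun c => localTranslation r (darbouxChart w w) c)
    (contMDiffOn_darbouxChart w) (contMDiffOn_darbouxChart_symm w) (isCompact_closedBall _ _) hball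
    (contDiff_localTranslation r _) (localTranslation r _ 0).injective ?_ z
  filter_upwards [Metric.closedBall_mem_nhds 0 hr] with c hc y
  exact localTranslation_eq_self_of_norm_le hr (mem_closedBall_zero_iff.1 hc)

lemma darbouxTranslation_center (hr : 0 < r) (hc : ‖c‖ ^ 2 ≤ r ^ 2 / 2) :
    darbouxTranslation w r c w = (darbouxChart w).symm (darbouxChart w w + (2 : ℝ) • c) := by
  rw [darbouxTranslation, extendByIdentity_of_mem (mem_darbouxChart_source w),
    localTranslation_center hr hc]

lemma eventually_exists_darbouxTranslation_eq (hr : 0 < r) (w : CotangentBundle n M)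
    {p : EuclideanSpace ℂ (Fin n) → Prop} (hp : ∀ᶠ c in 𝓝 0, p c) :
    ∀ᶠ z in 𝓝 w, ∃ c, p c ∧ darbouxTranslation w r c w = z := by
  have hw := mem_darbouxChart_source w
  have hcenter : Tendsto (fun z => (2⁻¹ : ℝ) • (darbouxChart w z - darbouxChart w w)) (𝓝 w)
      (𝓝 0) := by
    simpa only [sub_self, smul_zero] using
      (((darbouxChart w).continuousAt hw).tendsto.sub_const (darbouxChart w w)).const_smul
        (2⁻¹ : ℝ)
  have hsmall : ∀ᶠ c : EuclideanSpace ℂ (Fin n) in 𝓝 0, ‖c‖ ^ 2 < r ^ 2 / 2 :=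
    ((continuous_norm.pow 2).tendsto' 0 0 (by simp)).eventually_lt_const (by positivity)
  filter_upwards [hcenter.eventually (hp.and hsmall), (darbouxChart w).open_source.mem_nhds hw]
    with z ⟨hpz, hz⟩ hzw
  refine ⟨_, hpz, ?_⟩
  rw [darbouxTranslation_center hr hz.le, smul_inv_smul₀ two_ne_zero, add_sub_cancel,
    (darbouxChart w).left_inv hzw]

end DarbouxTranslation

lemma contDiffAt_iteratedFDeriv_param {X E F : Type*} [NormedAddCommGroup X] [NormedSpace ℝ X]
    [NormedAddCommGroup E] [NormedSpace ℝ E] [NormedAddCommGroup F] [NormedSpace ℝ F]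
    {G : X → E → F} {c : X} {y : E} (hG : ContDiffAt ℝ ∞ (fun x : X × E => G x.1 x.2) (c, y))
    (m : ℕ) : ContDiffAt ℝ ∞ (fun x : X × E => iteratedFDeriv ℝ m (G x.1) x.2) (c, y) := by
  induction m with
  | zero =>
    exact (continuousMultilinearCurryFin0 ℝ E F).symm.contDiff.contDiffAt.comp (c, y) hG
  | succ m ih =>
    have hderiv :
        ContDiffAt ℝ ∞ (fun x : X × E => fderiv ℝ (iteratedFDeriv ℝ m (G x.1)) x.2) (c, y) :=
      ContDiffAt.fderiv (f := fun (x : X × E) (v : E) => iteratedFDeriv ℝ m (G x.1) v)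
        (g := Prod.snd) (x₀ := (c, y)) (n := ∞)
        (ContDiffAt.comp ((c, y), y) (f := fun r : (X × E) × E => (r.1.1, r.2)) ih
          (by fun_prop)) contDiffAt_snd (by simp)
    exact (continuousMultilinearCurryLeftEquiv ℝ
      (fun _ : Fin (m + 1) => E) F).symm.contDiff.contDiffAt.comp (c, y) hderiv

namespace WhitneyNhd

variable {E : Type*} [NormedAddCommGroup E] [NormedSpace ℝ E]
  {H : Type*} [TopologicalSpace H] {I : ModelWithCorners ℝ E H}
  {P : Type*} [TopologicalSpace P] [ChartedSpace H P]
  {E' : Type*} [NormedAddCommGroup E'] [NormedSpace ℝ E']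
  {H' : Type*} [TopologicalSpace H'] {I' : ModelWithCorners ℝ E' H'}
  {N : Type*} [TopologicalSpace N] [ChartedSpace H' N]
  {f g : P → N} {a : ℕ} {q : P}

/-- The condition that `𝒰` imposes on the map `g` at a point `q` of `𝒰.K a`. -/
def ContainsAt (𝒰 : WhitneyNhd I I' f) (a : ℕ) (g : P → N) (q : P) : Prop :=
  g q ∈ (𝒰.chartN a).source ∧ ∀ m ≤ 𝒰.k,
    ‖iteratedFDeriv ℝ m (𝒰.inCharts a g) ((𝒰.chartP a).extend I q) -
      iteratedFDeriv ℝ m (𝒰.inCharts a f) ((𝒰.chartP a).extend I q)‖ < 𝒰.ε a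

lemma contains_iff (𝒰 : WhitneyNhd I I' f) :
    𝒰.Contains g ↔ ContMDiff I I' ∞ g ∧ ∀ a, ∀ q ∈ 𝒰.K a, 𝒰.ContainsAt a g q := by
  refine and_congr_right fun _ => forall_congr' fun a => ⟨fun h q hq => ?_, fun h => ?_⟩
  · exact ⟨h.1 hq, fun m hm => h.2 m hm _ (mem_image_of_mem _ hq)⟩
  · refine ⟨fun q hq => (h q hq).1, ?_⟩
    rintro m hm _ ⟨q, hq, rfl⟩
    exact (h q hq).2 m hm

lemma ContainsAt.of_eventuallyEq (𝒰 : WhitneyNhd I I' f) (hq : q ∈ 𝒰.K a) (hg : g =ᶠ[𝓝 q] f) :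
    𝒰.ContainsAt a g q := by
  refine ⟨hg.eq_of_nhds ▸ 𝒰.mapsTo a hq, fun m _ => ?_⟩
  have hqP := 𝒰.subset_source a hq
  have hsymm := (𝒰.chartP a).continuousAt_extend_symm (I := I) hqP
  rw [ContinuousAt, (𝒰.chartP a).extend_left_inv hqP] at hsymm
  have hcharts : 𝒰.inCharts a g =ᶠ[𝓝 ((𝒰.chartP a).extend I q)] 𝒰.inCharts a f := by
    filter_upwards [hsymm.eventually hg] with y hy
    exact congrArg ((𝒰.chartN a).extend I') hy
  rw [(hcharts.iteratedFDeriv ℝ m).eq_of_nhds, sub_self, norm_zero]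
  exact 𝒰.ε_pos a

variable [I.Boundaryless] {X : Type*} [NormedAddCommGroup X] [NormedSpace ℝ X] {G : X → P → N}

lemma contDiffAt_inCharts (𝒰 : WhitneyNhd I I' f) {c : X} (hq : q ∈ 𝒰.K a)
    (hGc : G c q ∈ (𝒰.chartN a).source)
    (hG : ContMDiffAt (𝓘(ℝ, X).prod I) I' ∞ (fun x : X × P => G x.1 x.2) (c, q)) :
    ContDiffAt ℝ ∞ (fun x : X × E => 𝒰.inCharts a (G x.1) x.2)
      (c, (𝒰.chartP a).extend I q) := by
  have hqP := 𝒰.subset_source a hq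
  have hsymm : ContMDiffAt 𝓘(ℝ, E) I ∞ ((𝒰.chartP a).extend I).symm
      ((𝒰.chartP a).extend I q) := by
    refine (contMDiffOn_extend_symm (𝒰.chartP_mem a)).contMDiffAt ?_
    exact (I.toHomeomorph.isOpenMap _ (𝒰.chartP a).open_target).mem_nhds
      ⟨_, (𝒰.chartP a).map_source hqP, rfl⟩
  have hleft := (𝒰.chartP a).extend_left_inv (I := I) hqP
  have hparam : ContMDiffAt 𝓘(ℝ, X × E) (𝓘(ℝ, X).prod I) ∞
      (fun x : X × E => (x.1, ((𝒰.chartP a).extend I).symm x.2))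
      (c, (𝒰.chartP a).extend I q) :=
    contDiffAt_fst.contMDiffAt.prodMk (hsymm.comp (c, (𝒰.chartP a).extend I q)
      contDiffAt_snd.contMDiffAt)
  have hfamily : ContMDiffAt 𝓘(ℝ, X × E) I' ∞
      (fun x : X × E => G x.1 (((𝒰.chartP a).extend I).symm x.2))
      (c, (𝒰.chartP a).extend I q) :=
    ContMDiffAt.comp_of_eq (g := fun x : X × P => G x.1 x.2) hG hparam (by rw [hleft])
  have hmem : G c (((𝒰.chartP a).extend I).symm ((𝒰.chartP a).extend I q)) ∈
      (𝒰.chartN a).source := by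
    rwa [hleft]
  exact (ContMDiffAt.comp_of_eq (g := (𝒰.chartN a).extend I')
    ((𝒰.chartN a).contMDiffAt_extend (𝒰.chartN_mem a) hmem) hfamily rfl).contDiffAt

lemma eventually_containsAt (𝒰 : WhitneyNhd I I' f) (hG₀ : G 0 = f) (hq : q ∈ 𝒰.K a)
    (hG : ContMDiffAt (𝓘(ℝ, X).prod I) I' ∞ (fun x : X × P => G x.1 x.2) (0, q)) :
    ∀ᶠ x : X × P in 𝓝 (0, q), 𝒰.ContainsAt a (G x.1) x.2 := by
  have hG0q : G 0 q ∈ (𝒰.chartN a).source := hG₀ ▸ 𝒰.mapsTo a hq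
  refine (hG.continuousAt.eventually ((𝒰.chartN a).open_source.mem_nhds hG0q)).and
    ((eventually_all_finite (finite_Iic 𝒰.k)).2 fun m _ => ?_)
  have hchart : ContinuousAt (fun x : X × P => (𝒰.chartP a).extend I x.2) (0, q) :=
    ContinuousAt.comp (f := Prod.snd)
      ((𝒰.chartP a).continuousAt_extend (𝒰.subset_source a hq)) continuousAt_snd
  have hderiv :=
    (contDiffAt_iteratedFDeriv_param (G := fun c => 𝒰.inCharts a (G c))
      (𝒰.contDiffAt_inCharts hq hG0q hG) m).continuousAt
  have hderivG := ContinuousAt.comp_of_eq hderiv (continuousAt_fst.prodMk hchart) rfl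
  have hderivf := ContinuousAt.comp_of_eq hderiv
    (continuousAt_const (y := (0 : X)).prodMk hchart) rfl
  have hlt := (hderivG.sub hderivf).norm.eventually_lt_const (u := 𝒰.ε a) (by
    simpa using 𝒰.ε_pos a)
  simpa only [Pi.sub_apply, Function.comp_apply, hG₀] using hlt

lemma eventually_contains (𝒰 : WhitneyNhd I I' f) (hG₀ : G 0 = f) {C : Set P} (hC : IsCompact C)
    (hCclosed : IsClosed C) (hGC : ∀ᶠ c in 𝓝 0, ∀ q ∉ C, G c q = f q)
    (hsmooth : ∀ᶠ c in 𝓝 0, ContMDiff I I' ∞ (G c))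
    (hG : ∀ q, ContMDiffAt (𝓘(ℝ, X).prod I) I' ∞ (fun x : X × P => G x.1 x.2) (0, q)) :
    ∀ᶠ c in 𝓝 0, 𝒰.Contains (G c) := by
  have hcompact : ∀ᶠ c in 𝓝 (0 : X), ∀ a ∈ {a | (𝒰.K a ∩ C).Nonempty}, ∀ q ∈ 𝒰.K a,
      𝒰.ContainsAt a (G c) q := by
    refine (eventually_all_finite (𝒰.locallyFinite.finite_nonempty_inter_compact hC)).2
      fun a _ => ?_
    exact (𝒰.isCompact a).eventually_forall_of_forall_eventually fun q hq =>
      𝒰.eventually_containsAt hG₀ hq (hG q)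
  filter_upwards [hcompact, hGC, hsmooth] with c hc hcC hcsmooth
  refine 𝒰.contains_iff.2 ⟨hcsmooth, fun a q hq => ?_⟩
  by_cases hqC : q ∈ C
  · exact hc a ⟨q, hq, hqC⟩ q hq
  · exact .of_eventuallyEq 𝒰 hq
      (by filter_upwards [hCclosed.isOpen_compl.mem_nhds hqC] with y hy using hcC y hy)

end WhitneyNhd

section Perturbation

variable {n : ℕ} {M : Type*} [TopologicalSpace M] [T2Space M] [ChartedSpace (RSpace n) M]
  [IsManifold (𝓡 n) ∞ M] {P : Type*} [TopologicalSpace P] [ChartedSpace (RSpace n) P]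
  {i : P → CotangentBundle n M}

namespace IsLagrangianEmbedding

lemma eventually_comp_darbouxTranslation (hi : IsLagrangianEmbedding i)
    (𝒰 : WhitneyNhd (𝓡 n) (cotangentModel n) i) {w : CotangentBundle n M} {r : ℝ} (hr : 0 < r)
    (hball : Metric.closedBall (darbouxChart w w) (2 * r) ⊆ (darbouxChart w).target)
    {C : Set P} (hC : IsCompact C)
    (hCi : i ⁻¹' ((darbouxChart w).symm '' Metric.closedBall (darbouxChart w w) (2 * r)) ⊆ C) :
    ∀ᶠ c in 𝓝 0, IsLagrangianEmbedding (darbouxTranslation w r c ∘ i) ∧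
      𝒰.Contains (darbouxTranslation w r c ∘ i) := by
  have : T2Space P := hi.isSmoothEmbedding.isEmbedding.t2Space
  have hsmall : ∀ᶠ c : EuclideanSpace ℂ (Fin n) in 𝓝 0, ‖c‖ ≤ r := by
    filter_upwards [Metric.closedBall_mem_nhds 0 hr] with c hc using mem_closedBall_zero_iff.1 hc
  have hlagrangian : ∀ᶠ c in 𝓝 0, IsLagrangianEmbedding (darbouxTranslation w r c ∘ i) :=
    hsmall.mono fun c hc =>
      (isSymplectomorphism_darbouxTranslation hr hc hball).comp_isLagrangianEmbedding hi
  refine hlagrangian.and (𝒰.eventually_contains (G := fun c => darbouxTranslation w r c ∘ i)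
    (by rw [darbouxTranslation_zero, Function.id_comp]) hC hC.isClosed ?_
    (hlagrangian.mono fun c hc => hc.isSmoothEmbedding.contMDiff) fun q => ?_)
  · filter_upwards [hsmall] with c hc q hq
    exact darbouxTranslation_eq_self hr hc fun h => hq (hCi h)
  · exact ContMDiffAt.comp_of_eq
      (g := fun x : EuclideanSpace ℂ (Fin n) × CotangentBundle n M =>
        darbouxTranslation w r x.1 x.2)
      (f := fun x : EuclideanSpace ℂ (Fin n) × P => (x.1, i x.2))
      (contMDiffAt_darbouxTranslation hr hball (i q))
      (contMDiffAt_fst.prodMk ((hi.isSmoothEmbedding.contMDiff q).comp (0, q) contMDiffAt_snd)) rfl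

lemma eventually_exists_contains (hi : IsLagrangianEmbedding i)
    (𝒰 : WhitneyNhd (𝓡 n) (cotangentModel n) i) (q : P) :
    ∀ᶠ z in 𝓝 (i q), ∃ j : P → CotangentBundle n M,
      IsLagrangianEmbedding j ∧ 𝒰.Contains j ∧ z ∈ range j := by
  have := ChartedSpace.locallyCompactSpace (RSpace n) P
  obtain ⟨C, hC, hCq⟩ := exists_compact_mem_nhds q
  obtain ⟨W, hW, hWC⟩ := (hi.isSmoothEmbedding.isEmbedding.nhds_eq_comap q ▸ hCq :
    C ∈ comap i (𝓝 (i q)))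
  obtain ⟨ρ, hρ, hball, hballW⟩ :=
    exists_closedBall_subset_target (darbouxChart (i q)) (mem_darbouxChart_source _) hW
  obtain ⟨r, rfl⟩ : ∃ r, ρ = 2 * r := ⟨ρ / 2, by ring⟩
  have hr : 0 < r := by linarith
  have hcontains := hi.eventually_comp_darbouxTranslation 𝒰 hr hball hC
    ((preimage_mono hballW).trans hWC)
  filter_upwards [eventually_exists_darbouxTranslation_eq hr (i q) hcontains]
    with z ⟨c, ⟨hj, hj𝒰⟩, hcz⟩
  exact ⟨_, hj, hj𝒰, q, hcz⟩

end IsLagrangianEmbedding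

theorem mainTheorem7_general {A : Set (CotangentBundle n M)} (hi : IsLagrangianEmbedding i)
    (hA : (closure A ∩ range i).Nonempty) (𝒰 : WhitneyNhd (𝓡 n) (cotangentModel n) i) :
    ∃ j : P → CotangentBundle n M, IsLagrangianEmbedding j ∧ 𝒰.Contains j ∧
      (A ∩ range j).Nonempty := by
  obtain ⟨_, hw, q, rfl⟩ := hA
  obtain ⟨z, hz, j, hj, hj𝒰, hzj⟩ := (mem_closure_iff_frequently.1 hw).and_eventually
    (hi.eventually_exists_contains 𝒰 q) |>.exists
  exact ⟨j, hj, hj𝒰, z, hz, hzj⟩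

end Perturbation

end

theorem mainTheorem7 {n : ℕ} {M : Type*} [TopologicalSpace M] [T2Space M]
    [SecondCountableTopology M] [ChartedSpace (RSpace n) M] [IsManifold (𝓡 n) ∞ M]
    (𝓗 : HybridHamiltonianSystem n M) (hspasmodic : 𝓗.FreeOfSpasmodicZeno)
    (x : M) (hx : 𝓗.AlmostNoSteadyZeno x) (T : ℝ) (hT : 0 ≤ T)
    {P : Type*} [TopologicalSpace P] [ChartedSpace (RSpace n) P] [IsManifold (𝓡 n) ∞ P]
    (i : P → CotangentBundle n M) (hi : IsLagrangianEmbedding i)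
    (hmiss : 𝓗.lift.flowImage T (𝓗.nonZenoFiber x) ∩ range i = ∅)
    (hclosure : (closure (𝓗.lift.flowImage T (𝓗.nonZenoFiber x)) ∩ range i).Nonempty)
    (𝒰 : WhitneyNhd (𝓡 n) (cotangentModel n) i) :
    ∃ j : P → CotangentBundle n M, IsLagrangianEmbedding j ∧ 𝒰.Contains j ∧
      (𝓗.lift.flowImage T (𝓗.nonZenoFiber x) ∩ range j).Nonempty :=
  mainTheorem7_general hi hclosure 𝒰
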